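/- A cubic ribbon graph $\Gamma$ is a finite trivalent graph (multiple edges, loops and several connected components allowed, as well as trivial components, i.e. single edges without vertices closing upon themselves) with a cyclic ordering of the three half-edges at each vertex. A spin network $(\Gamma,\gamma)$ is a cubic ribbon graph with a decoration $\gamma:E(\Gamma)\to\mathbb{N}$ such that at each vertex $v$ the decorations $a_v,b_v,c_v$ of the three incident half-edges (the decoration of a loop is counted twice) satisfy: $a_v+b_v+c_v$ is even and $|a_v-b_v|\le c_v\le a_v+b_v$. Thicken $\Gamma$ to an oriented surface, with a disc for each vertex and an untwisted band for each edge, according to the cyclic orderings. Draw $\gamma(e)$ parallel strands along each edge $e$, and at each vertex connect the strands inside the disc without crossings, so that $\frac{a_v+b_v-c_v}{2}$ strands join the $a_v$ edge to the $b_v$ edge, and similarly for the other two pairs. A state $\sigma=(\sigma_e)_e$ is a choice of a permutation $\sigma_e\in\mathfrak{S}_{\gamma(e)}$ of the strands for each edge $e$; inserting these permutations into the bands produces a number $k(\sigma)$ of closed curves. The Penrose and the standard evaluations are $$\langle\Gamma,\gamma\rangle^P=\sum_{\sigma}\Big(\prod_{e}\operatorname{sign}(\sigma_e)\Big)(-2)^{k(\sigma)},$$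 $$\langle\Gamma,\gamma\rangle^S=\langle\Gamma,\gamma\rangle^P\prod_{v\in V(\Gamma)}\left\{\left(\tfrac{a_v+b_v-c_v}{2}\right)!\left(\tfrac{a_v+c_v-b_v}{2}\right)!\left(\tfrac{b_v+c_v-a_v}{2}\right)!\right\}^{-1}.$$ The spectral radius $\rho_{\Gamma,\gamma}\in[0,\infty]$ is the inverse of the radius of convergence of the power series $\sum_{n\ge 0}\langle\Gamma,n\gamma\rangle^S z^n$. **Corollary.** For any spin network $(\Gamma,\gamma)$ without trivial components and with uniform decoration $\gamma(e)=2$ for every edge $e$, $$\rho_{\Gamma,\gamma}\le 3^{\frac{3|V(\Gamma)|}{2}}.$$ -/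

import Mathlib

universe u

/-- A finite cubic ribbon graph. Multiple edges, loops and several connected components are
allowed, and so are trivial components: a single edge, without vertices, closing upon itself.
`Vert` is the set of vertices, `PropEdge` the set of edges which have ends at vertices, and `Triv`
the set of trivial components. The two ends (half-edges) of an edge `e : PropEdge` are `(e, false)`
and `(e, true)`. The slots `(v, 0), (v, 1), (v, 2)` are the three places around the vertex `v`,
listed in the cyclic order (counterclockwise) of the rotation system; `attach` tells which
half-edge sits at which slot, each half-edge sitting at exactly one. -/
structure CubicRibbonGraph where
  Vert : Type u
  PropEdge : Type u
  Triv : Type u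
  [fintypeVert : Fintype Vert]
  [fintypePropEdge : Fintype PropEdge]
  [fintypeTriv : Fintype Triv]
  attach : Vert × Fin 3 ≃ PropEdge × Bool

namespace CubicRibbonGraph

attribute [instance] fintypeVert fintypePropEdge fintypeTriv

/-- All the edges: those with ends at vertices, and those which form trivial components. -/
abbrev Edge (G : CubicRibbonGraph.{u}) : Type u := G.PropEdge ⊕ G.Triv

/-- The half-edge at slot `k` of the vertex `v`. -/
def halfEdge (G : CubicRibbonGraph.{u}) (v : G.Vert) (k : Fin 3) : G.Edge × Bool :=
  (Sum.inl (G.attach (v, k)).1, (G.attach (v, k)).2)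

/-- The decoration of the edge at slot `k` of the vertex `v`. A loop at `v` occupies two slots
of `v`, hence is counted twice. -/
def deco (G : CubicRibbonGraph.{u}) (γ : G.Edge → ℕ) (v : G.Vert) (k : Fin 3) : ℕ :=
  γ (G.halfEdge v k).1

/-- At each vertex `a + b + c` is even and `|a - b| ≤ c ≤ a + b`. -/
def Admissible (G : CubicRibbonGraph.{u}) (γ : G.Edge → ℕ) : Prop :=
  ∀ v : G.Vert,
    Even (G.deco γ v 0 + G.deco γ v 1 + G.deco γ v 2) ∧
    |(G.deco γ v 0 : ℤ) - (G.deco γ v 1 : ℤ)| ≤ (G.deco γ v 2 : ℤ) ∧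
    G.deco γ v 2 ≤ G.deco γ v 0 + G.deco γ v 1

/-- The endpoints of the strands: the edge `e` carries `γ e` strands, hence `γ e` endpoints on each
of its two half-edges. On each half-edge they are numbered `0, 1, …, γ e - 1` in the
counterclockwise sense around the disc (vertex) to which the half-edge is attached. -/
abbrev StrandEnd (G : CubicRibbonGraph.{u}) (γ : G.Edge → ℕ) : Type u :=
  (h : G.Edge × Bool) × Fin (γ h.1)

/-- A state: one permutation of the strands for the Penrose bar of each edge. -/
abbrev State (G : CubicRibbonGraph.{u}) (γ : G.Edge → ℕ) : Type u :=
  (e : G.Edge) → Equiv.Perm (Fin (γ e))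

/-- The elementary pieces of curve in the state `σ`.

* Along the band of an edge, the strand starting at place `i` of one end arrives at the other end
  in front of place `σ e i`. The band is untwisted and the two ends are numbered counterclockwise
  around their respective discs, so that parallel strands (`σ e = 1`) join `i` to `Fin.rev i`.
* At a vertex with decorations `a, b, c` in cyclic order, the last `(a + b - c) / 2` strands of the
  `a` edge are joined, without crossings, to the first `(a + b - c) / 2` strands of the next edge,
  the `b` edge.
* In a trivial component the two ends of the band are glued to each other. -/
inductive Joined (G : CubicRibbonGraph.{u}) (γ : G.Edge → ℕ) (σ : G.State γ) :
    G.StrandEnd γ → G.StrandEnd γ → Prop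
  | bar (e : G.Edge) (i : Fin (γ e)) :
      Joined G γ σ ⟨(e, false), i⟩ ⟨(e, true), Fin.rev (σ e i)⟩
  | vertex (v : G.Vert) (k : Fin 3) (i : Fin (G.deco γ v k)) (j : Fin (G.deco γ v (k + 1)))
      (hij : (i : ℕ) + (j : ℕ) + 1 = G.deco γ v k)
      (hj : (j : ℕ) < (G.deco γ v k + G.deco γ v (k + 1) - G.deco γ v (k + 2)) / 2) :
      Joined G γ σ ⟨G.halfEdge v k, i⟩ ⟨G.halfEdge v (k + 1), j⟩
  | triv (t : G.Triv) (i : Fin (γ (Sum.inr t))) :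
      Joined G γ σ ⟨(Sum.inr t, false), i⟩ ⟨(Sum.inr t, true), Fin.rev i⟩

/-- The number of closed curves in the state `σ`: the number of classes of strand ends modulo the
equivalence relation generated by `Joined`. -/
noncomputable def numCurves (G : CubicRibbonGraph.{u}) (γ : G.Edge → ℕ) (σ : G.State γ) : ℕ :=
  Nat.card (Quot (G.Joined γ σ))

open Classical in
/-- The Penrose evaluation: the sum over all states of `-1` to the number of crossings
(whose parity at a bar is that of the permutation) times `-2` to the number of closed curves. -/
noncomputable def penroseEval (G : CubicRibbonGraph.{u}) (γ : G.Edge → ℕ) : ℤ :=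
  ∑ σ : G.State γ, (∏ e : G.Edge, (Equiv.Perm.sign (σ e) : ℤ)) * (-2) ^ G.numCurves γ σ

/-- The standard evaluation: the Penrose evaluation divided, for each vertex, by
`((a + b - c) / 2)! ((a + c - b) / 2)! ((b + c - a) / 2)!`. -/
noncomputable def standardEval (G : CubicRibbonGraph.{u}) (γ : G.Edge → ℕ) : ℝ :=
  (G.penroseEval γ : ℝ) *
    ∏ v : G.Vert,
      ((((G.deco γ v 0 + G.deco γ v 1 - G.deco γ v 2) / 2).factorial *
        ((G.deco γ v 0 + G.deco γ v 2 - G.deco γ v 1) / 2).factorial *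
        ((G.deco γ v 1 + G.deco γ v 2 - G.deco γ v 0) / 2).factorial : ℕ) : ℝ)⁻¹

end CubicRibbonGraph

/-- A classical spin network: a cubic ribbon graph with an admissible decoration. -/
structure SpinNetwork extends CubicRibbonGraph.{u} where
  γ : toCubicRibbonGraph.Edge → ℕ
  admissible : toCubicRibbonGraph.Admissible γ

namespace SpinNetwork

/-- The standard evaluation of a spin network. -/
noncomputable def standardEval (N : SpinNetwork.{u}) : ℝ :=
  N.toCubicRibbonGraph.standardEval N.γ

/-- The dilation of a spin network: each decoration is multiplied by `n`. -/
def dilate (N : SpinNetwork.{u}) (n : ℕ) : SpinNetwork.{u} where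
  toCubicRibbonGraph := N.toCubicRibbonGraph
  γ := fun e => n * N.γ e
  admissible := by
    intro v
    obtain ⟨h1, h2, h3⟩ := N.admissible v
    simp only [CubicRibbonGraph.deco] at h1 h2 h3 ⊢
    refine ⟨?_, ?_, ?_⟩
    · rw [← mul_add, ← mul_add]
      exact h1.mul_left n
    · push_cast
      rw [← mul_sub, abs_mul, Nat.abs_cast]
      exact mul_le_mul_of_nonneg_left h2 (Int.natCast_nonneg n)
    · rw [← mul_add]
      exact Nat.mul_le_mul_left n h3

/-- The power series whose coefficient of `z ^ n` is the standard evaluation of the `n`-th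
dilation. -/
noncomputable def generatingSeries (N : SpinNetwork.{u}) : FormalMultilinearSeries ℝ ℝ ℝ :=
  FormalMultilinearSeries.ofScalars ℝ (fun n : ℕ => (N.dilate n).standardEval)

/-- The spectral radius, in `[0, ∞]`: the inverse of the radius of convergence of the generating
series, with the conventions `1 / 0 = ∞` and `1 / ∞ = 0`. -/
noncomputable def spectralRadius (N : SpinNetwork.{u}) : ENNReal :=
  N.generatingSeries.radius⁻¹

end SpinNetwork

/-! The weight `-2` of a closed curve is the contraction of the alternating form on `ℂ²` around a
loop. Colour the strand ends by `Bool`, the basis of `ℂ²`, and put `boolAlt` on every strand and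
every arc inside a vertex. The sum over colourings of the product is `(-2)` to the number of curves,
up to a sign (`sum_prod_boolAlt`), and this sign is the sign of the state up to a factor common to
all states. Hence the Penrose evaluation is, up to a global sign, a tensor contraction
(`exists_penroseEval_eq_contraction`), in which the sum over permutations gives each edge a tensor
symmetric in its strands.

Such a tensor on `c` strands is a combination of products `u^{⊗c} ⊗ v^{⊗c}` of unit vectors whose
coefficients have total size at most `(c + 1) ^ 2 * c!` (`exists_antisymmetrizer_decomposition`), so
that beyond `c!` only a polynomial factor is lost. With decoration `2n`, a vertex contracts three
such vectors to the `n`-th power of the product of their pairwise alternating forms. The squared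
modulus of `altForm` at two unit vectors is a quarter of the squared chord between the corresponding
points of the sphere; three points on a sphere therefore bound the product by `√(27/64)`
(`prod_norm_altForm_le`).

Write `V` and `E` for the numbers of vertices and edges. Then `3V = 2E`, so the vertex factorials
multiply to `(n!) ^ (2E)`. Since `(2n)! / (n!)² ≤ 4 ^ n`, the growth rate is at most `4 ^ E *
(27/64) ^ (V/2) = 27 ^ (V/2) = 3 ^ (3V/2)`. -/

/-- Two relations have equally many classes if there are maps between their carriers which
respect the classes and are inverse to each other on the classes. -/
theorem card_quot_congr {α β : Type*} {r : α → α → Prop} {r' : β → β → Prop} (f : α → β) (g : β → α)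
    (hf : ∀ x y, r x y → Quot.mk r' (f x) = Quot.mk r' (f y))
    (hg : ∀ x y, r' x y → Quot.mk r (g x) = Quot.mk r (g y))
    (hgf : ∀ x, Quot.mk r (g (f x)) = Quot.mk r x)
    (hfg : ∀ y, Quot.mk r' (f (g y)) = Quot.mk r' y) :
    Nat.card (Quot r) = Nat.card (Quot r') :=
  Nat.card_congr
    { toFun := Quot.lift (fun x => Quot.mk r' (f x)) hf
      invFun := Quot.lift (fun y => Quot.mk r (g y)) hg
      left_inv := by rintro ⟨x⟩; exact hgf x
      right_inv := by rintro ⟨y⟩; exact hfg y }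

/-! ### Sign and number of orbits of a permutation -/

namespace Equiv.Perm

variable {α : Type*} [Fintype α] [DecidableEq α]

/-- The number of orbits of a permutation: its cycles together with its fixed points. -/
theorem card_quotient_sameCycle (π : Perm α) :
    Nat.card (Quotient (SameCycle.setoid π)) =
      π.cycleFactorsFinset.card + (Finset.univ.filter fun x => π x = x).card := by
  classical
  have hout : ∀ x : α, SameCycle π (Quotient.mk (SameCycle.setoid π) x).out x := fun x =>
    Quotient.exact (Quotient.out_eq (Quotient.mk (SameCycle.setoid π) x))
  have hmk : ∀ p q : Quotient (SameCycle.setoid π), SameCycle π p.out q.out → p = q := by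
    intro p q h
    rw [← Quotient.out_eq p, ← Quotient.out_eq q]
    exact Quotient.sound h
  rw [Nat.card_eq_fintype_card, ← Finset.card_univ, ← Finset.card_disjSum]
  refine Finset.card_bij
    (fun q _ => if π q.out = q.out then Sum.inr q.out else Sum.inl (π.cycleOf q.out)) ?_ ?_ ?_
  · intro q _
    split_ifs with h
    · simpa [Finset.inr_mem_disjSum] using h
    · rw [Finset.inl_mem_disjSum, cycleOf_mem_cycleFactorsFinset_iff]
      simpa [mem_support] using h
  · intro p _ q _ h
    split_ifs at h with h1 h2 h2
    · exact hmk p q (by rw [Sum.inr.inj h])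
    · refine hmk p q ?_
      have h3 := Sum.inl.inj h
      by_contra hne
      have h4 : π.cycleOf p.out q.out = q.out := cycleOf_apply_of_not_sameCycle hne
      rw [h3, cycleOf_apply_self] at h4
      exact h2 h4
  · intro y hy
    rcases y with c | x
    · rw [Finset.inl_mem_disjSum] at hy
      obtain ⟨x, hx⟩ := (mem_cycleFactorsFinset_iff.mp hy).1
      have hxs : x ∈ c.support := by simpa [mem_support] using hx.1
      have hc : c = π.cycleOf x := cycle_is_cycleOf hxs hy
      have hx' : π x ≠ x := by
        have := mem_cycleFactorsFinset_support_le hy hxs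
        simpa [mem_support] using this
      refine ⟨Quotient.mk _ x, Finset.mem_univ _, ?_⟩
      have h1 := hout x
      rw [if_neg, h1.cycleOf_eq, hc]
      intro h2
      exact hx' (h1.apply_eq_self_iff.mp h2)
    · rw [Finset.inr_mem_disjSum] at hy
      have hx : π x = x := by simpa using hy
      refine ⟨Quotient.mk _ x, Finset.mem_univ _, ?_⟩
      have h1 := hout x
      have h2 := h1.apply_eq_self_iff.mpr hx
      rw [if_pos h2]
      congr 1
      obtain ⟨i, hi⟩ := h1
      exact (zpow_apply_eq_self_of_apply_eq_self h2 i).symm.trans hi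

/-- The sign of a permutation is determined by the number of its orbits. -/
theorem sign_eq_neg_one_pow_orbits (π : Perm α) :
    (sign π : ℤ) = (-1) ^ (Fintype.card α + Nat.card (Quot fun x y => π x = y)) := by
  have hQ : Nat.card (Quot fun x y => π x = y) = Nat.card (Quotient (SameCycle.setoid π)) := by
    refine card_quot_congr id id (fun x y h => Quotient.sound ?_) (fun x y h => ?_)
      (fun _ => rfl) (fun _ => rfl)
    · exact ⟨1, by simpa using h⟩
    · obtain ⟨n, rfl⟩ := SameCycle.exists_nat_pow_eq h
      clear h
      induction n with
      | zero => rfl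
      | succ n ih =>
        rw [ih, pow_succ', mul_apply]
        exact Quot.sound rfl
  rw [hQ, card_quotient_sameCycle, sign_of_cycleType]
  have h1 : (Finset.univ.filter fun x => π x = x).card + π.support.card = Fintype.card α := by
    rw [← Finset.card_univ,
      ← Finset.card_filter_add_card_filter_not (s := Finset.univ) (fun x => π x = x)]
    congr 1
  have h2 : π.cycleFactorsFinset.card = Multiset.card π.cycleType := by
    simp [cycleType_def]
  rw [h2, sum_cycleType, ← h1]
  push_cast
  rw [show (Finset.univ.filter fun x => π x = x).card + π.support.card +
    (Multiset.card π.cycleType + (Finset.univ.filter fun x => π x = x).card) =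
    2 * (Finset.univ.filter fun x => π x = x).card + (π.support.card + Multiset.card π.cycleType)
    by ring, pow_add (-1 : ℤ) (2 * _), pow_mul (-1 : ℤ) 2, pow_add]
  simp

end Equiv.Perm

/-! ### Two-colourings of pairs of matchings and the loop value -/

/-- Two fixed-point-free involutions have a common proper colouring by two colours. -/
theorem exists_bool_coloring {X : Type*} (f t : Equiv.Perm X) (hf : ∀ x, f (f x) = x)
    (ht : ∀ x, t (t x) = x) (hf' : ∀ x, f x ≠ x) (ht' : ∀ x, t x ≠ x) :
    ∃ s : X → Bool, ∀ x, s (f x) = !s x ∧ s (t x) = !s x := by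
  classical
  set π : Equiv.Perm X := f * t with hπ
  have hff : f⁻¹ = f := by
    ext x; rw [Equiv.Perm.inv_eq_iff_eq, hf]
  have htt : t⁻¹ = t := by
    ext x; rw [Equiv.Perm.inv_eq_iff_eq, ht]
  have htt1 : t * t = 1 := by ext x; simp [ht]
  have hff1 : f * f = 1 := by ext x; simp [hf]
  have hconj : t * π * t⁻¹ = π⁻¹ := by
    rw [hπ, mul_inv_rev, hff, htt, mul_assoc, mul_assoc, htt1, mul_one]
  have hconjz : ∀ n : ℤ, t * π ^ n = π ^ (-n) * t := by
    intro n
    have := congrArg (· ^ n) hconj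
    simp only [conj_zpow, inv_zpow'] at this
    rw [← this]; group
  have hsame : ∀ x y, π.SameCycle x y → π.SameCycle (t x) (t y) := by
    rintro x _ ⟨n, rfl⟩
    refine ⟨-n, ?_⟩
    rw [← Equiv.Perm.mul_apply, ← hconjz, Equiv.Perm.mul_apply]
  have hne : ∀ x, ¬ π.SameCycle x (t x) := by
    rintro x ⟨n, hn⟩
    -- If `t` preserved an orbit of `π`, it would act there as a reflection: a midpoint would be
    -- fixed by `t` for even `n`, by `f` for odd `n`.
    rcases Int.even_or_odd' n with ⟨i, rfl | rfl⟩
    · apply ht' ((π ^ i) x)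
      rw [← Equiv.Perm.mul_apply, hconjz, Equiv.Perm.mul_apply, ← hn, ← Equiv.Perm.mul_apply,
        ← zpow_add]
      congr 2; ring
    · apply hf' ((π ^ (i + 1)) x)
      have h1 : f * π ^ (i + 1) = π ^ (-i) * t := by
        rw [← hconjz, add_comm, zpow_add, zpow_one, ← mul_assoc]
        congr 1
        rw [hπ, ← mul_assoc, hff1, one_mul]
      rw [← Equiv.Perm.mul_apply, h1, Equiv.Perm.mul_apply, ← hn, ← Equiv.Perm.mul_apply,
        ← zpow_add]
      congr 2; ring
  -- So `t` pairs the orbits of `π` without fixed points, and an arbitrary linear order picks one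
  -- orbit from each pair. Since `f x = π (t x)`, the points `f x` and `t x` share an orbit, hence a
  -- colour.
  let Q := Quotient (Equiv.Perm.SameCycle.setoid π)
  let T : Q → Q := Quotient.map t hsame
  let _ : LinearOrder Q := linearOrderOfSTO WellOrderingRel
  have hTT : ∀ x : X, T (T (Quotient.mk _ x)) = Quotient.mk _ x := fun x => by
    simp [T, Quotient.map_mk, ht]
  have hTne : ∀ x : X, T (Quotient.mk _ x) ≠ Quotient.mk _ x := fun x h =>
    hne x (Quotient.exact h).symm
  have hst : ∀ x : X, decide ((Quotient.mk _ (t x) : Q) < T (Quotient.mk _ (t x))) =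
      !decide ((Quotient.mk _ x : Q) < T (Quotient.mk _ x)) := by
    intro x
    have h1 : (Quotient.mk _ (t x) : Q) = T (Quotient.mk _ x) := rfl
    rw [h1, hTT, ← decide_not, decide_eq_decide, not_lt]
    exact ⟨le_of_lt, fun h => lt_of_le_of_ne h (hTne x)⟩
  refine ⟨fun x => decide ((Quotient.mk _ x : Q) < T (Quotient.mk _ x)), fun x => ⟨?_, hst x⟩⟩
  have h2 : (Quotient.mk _ (f x) : Q) = Quotient.mk _ (t x) := by
    refine Quotient.sound (Equiv.Perm.SameCycle.symm ⟨1, ?_⟩)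
    simp [hπ, ht]
  change decide ((Quotient.mk _ (f x) : Q) < T (Quotient.mk _ (f x))) = _
  rw [h2]
  exact hst x

/-- The alternating form on pairs of colours. -/
def boolAlt (x y : Bool) : ℤ := if x = y then 0 else if x then -1 else 1

/-- Two points are related if they are the ends, in this order, of an arc of one of two
matchings. -/
def MatchRel {I J X : Type*} (φ : J × Bool → X) (ψ : I × Bool → X) (p q : X) : Prop :=
  (∃ i, p = φ (i, false) ∧ q = φ (i, true)) ∨ ∃ i, p = ψ (i, false) ∧ q = ψ (i, true)

section Matchings

variable {I X : Type*}

/-- A colouring of the points is proper if the ends of each arc have different colours. -/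
def IsProper (φ : I × Bool ≃ X) (s : X → Bool) : Prop := ∀ i, s (φ (i, true)) = !s (φ (i, false))

/-- Reversal of those arcs whose tails have the colour `true`. -/
def reversal (φ : I × Bool ≃ X) (s : X → Bool) : Equiv.Perm (I × Bool) :=
  Equiv.prodCongrRight fun i => if s (φ (i, false)) then Equiv.swap false true else 1

theorem reversal_involutive (φ : I × Bool ≃ X) (s : X → Bool) (p : I × Bool) :
    reversal φ s (reversal φ s p) = p := by
  obtain ⟨i, x⟩ := p
  simp only [reversal, Equiv.prodCongrRight_apply]
  split_ifs <;> simp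

theorem IsProper.color_reversal {φ : I × Bool ≃ X} {s : X → Bool} (h : IsProper φ s) (i : I)
    (x : Bool) : s (φ (reversal φ s (i, x))) = x := by
  have := h i
  simp only [reversal, Equiv.prodCongrRight_apply]
  cases h0 : s (φ (i, false)) <;> cases x <;> simp_all

/-- An arc is swapped exactly when its tail is `true`, which is when its factor `boolAlt` is `-1`.
-/
theorem IsProper.sign_reversal [Fintype I] [DecidableEq I] {φ : I × Bool ≃ X}
    {s : X → Bool} (h : IsProper φ s) :
    (Equiv.Perm.sign (reversal φ s) : ℤ) =
      ∏ i, boolAlt (s (φ (i, false))) (s (φ (i, true))) := by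
  rw [reversal, Equiv.Perm.sign_prodCongrRight, Units.coe_prod]
  refine Finset.prod_congr rfl fun i _ => ?_
  rw [h i, boolAlt]
  cases s (φ (i, false)) <;> simp

theorem prod_boolAlt_eq_zero [Fintype I] {φ : I × Bool ≃ X} {s : X → Bool} (h : ¬ IsProper φ s) :
    ∏ i, boolAlt (s (φ (i, false))) (s (φ (i, true))) = 0 := by
  simp only [IsProper, not_forall] at h
  obtain ⟨i, hi⟩ := h
  refine Finset.prod_eq_zero (Finset.mem_univ i) ?_
  rw [boolAlt, if_pos]
  revert hi
  cases s (φ (i, false)) <;> cases s (φ (i, true)) <;> simp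

/-- The sign attached to a common proper colouring of two matchings depends only on the number
of closed curves they form. -/
theorem IsProper.prod_boolAlt [Fintype I] [DecidableEq I] {φ ψ : I × Bool ≃ X}
    {s : X → Bool} (hφ : IsProper φ s)
    (hψ : IsProper ψ s) :
    (∏ i, boolAlt (s (φ (i, false))) (s (φ (i, true)))) *
      ∏ i, boolAlt (s (ψ (i, false))) (s (ψ (i, true))) =
    Equiv.Perm.sign (φ.trans ψ.symm) *
      (-1) ^ (Fintype.card I + Nat.card (Quot (MatchRel φ ψ))) := by
  -- Reorient every arc from colour `false` to colour `true`. The comparison `β` of the two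
  -- matchings then preserves colours and splits into one permutation of `I` for each colour.
  set φ' : I × Bool ≃ X := (reversal φ s).trans φ with hφ'
  set ψ' : I × Bool ≃ X := (reversal ψ s).trans ψ with hψ'
  have cφ : ∀ i x, s (φ' (i, x)) = x := hφ.color_reversal
  have cψ : ∀ i x, s (ψ' (i, x)) = x := hψ.color_reversal
  set β : Equiv.Perm (I × Bool) := φ'.trans ψ'.symm with hβ
  have hβψ : ∀ p, ψ' (β p) = φ' p := fun p => by simp [hβ]
  have hβ2 : ∀ i x, (β (i, x)).2 = x := by
    intro i x
    have h1 := cψ (β (i, x)).1 (β (i, x)).2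
    rw [Prod.mk.eta, hβψ, cφ] at h1
    exact h1.symm
  have hβ1 : ∀ i x, β (i, x) = ((β (i, x)).1, x) := fun i x => Prod.ext rfl (hβ2 i x)
  have hinj : ∀ x, Function.Injective fun i => (β (i, x)).1 := by
    intro x i j hij
    have : β (i, x) = β (j, x) := by rw [hβ1 i, hβ1 j]; exact Prod.ext hij rfl
    simpa using this
  let B : Bool → Equiv.Perm I := fun x =>
    Equiv.ofBijective _ (Finite.injective_iff_bijective.mp (hinj x))
  have hB : ∀ i x, β (i, x) = (B x i, x) := hβ1
  have hβB : β = Equiv.prodCongrLeft B := by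
    ext1 ⟨i, x⟩
    rw [hB]; rfl
  have hsβ : Equiv.Perm.sign β = Equiv.Perm.sign (B true * (B false)⁻¹) := by
    rw [hβB, Equiv.Perm.sign_prodCongrLeft]
    simp [mul_comm]
  -- `B true * (B false)⁻¹` moves from a `ψ` arc, through the `φ` arc at its end of colour `false`,
  -- to the next `ψ` arc; its orbits are the closed curves.
  have hQ : Nat.card (Quot (MatchRel φ ψ)) =
      Nat.card (Quot fun x y => (B true * (B false)⁻¹) x = y) := by
    have hψrel : ∀ i x, Quot.mk (MatchRel φ ψ) (ψ (i, x)) = Quot.mk _ (ψ (i, false)) := by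
      intro i x
      cases x
      · rfl
      · exact (Quot.sound (r := MatchRel φ ψ) (Or.inr ⟨i, rfl, rfl⟩)).symm
    have hφrel : ∀ i x, Quot.mk (MatchRel φ ψ) (φ (i, x)) = Quot.mk _ (φ (i, false)) := by
      intro i x
      cases x
      · rfl
      · exact (Quot.sound (r := MatchRel φ ψ) (Or.inl ⟨i, rfl, rfl⟩)).symm
    have hψ'rel : ∀ i x, Quot.mk (MatchRel φ ψ) (ψ' (i, x)) = Quot.mk _ (ψ (i, false)) :=
      fun i x => hψrel i _
    have hφ'rel : ∀ i x, Quot.mk (MatchRel φ ψ) (φ' (i, x)) = Quot.mk _ (φ (i, false)) :=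
      fun i x => hφrel i _
    have hF : ∀ p, (ψ'.symm p).1 = (ψ.symm p).1 := by
      intro p
      obtain ⟨⟨i, x⟩, rfl⟩ := ψ'.surjective p
      rw [Equiv.symm_apply_apply, hψ', Equiv.trans_apply, Equiv.symm_apply_apply]
      rfl
    have hFφ : ∀ i x, (ψ.symm (φ' (i, x))).1 = B x i := by
      intro i x
      rw [← hF, ← hβψ, Equiv.symm_apply_apply, hB]
    refine card_quot_congr (fun p => (ψ.symm p).1) (fun i => ψ (i, false)) ?_ ?_ ?_ ?_
    · rintro _ _ (⟨i, rfl, rfl⟩ | ⟨i, rfl, rfl⟩)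
      · have key : ∀ x, Quot.mk (fun x y => (B true * (B false)⁻¹) x = y)
            (ψ.symm (φ' (i, x))).1 = Quot.mk _ (B false i) := by
          intro x
          rw [hFφ]
          cases x
          · rfl
          · exact (Quot.sound (by simp)).symm
        have key2 : ∀ x, Quot.mk (fun x y => (B true * (B false)⁻¹) x = y)
            (ψ.symm (φ (i, x))).1 = Quot.mk _ (B false i) := by
          intro x
          have := key (reversal φ s (i, x)).2
          rw [hφ', Equiv.trans_apply] at this
          rwa [show (i, (reversal φ s (i, x)).2) = reversal φ s (i, x) from rfl,
            reversal_involutive] at this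
        exact (key2 false).trans (key2 true).symm
      · simp
    · rintro i _ rfl
      obtain ⟨j, rfl⟩ := (B false).surjective i
      rw [← hψ'rel _ false, ← hψ'rel _ true]
      have h1 : (B true * (B false)⁻¹) (B false j) = B true j := by simp
      rw [h1]
      rw [← hB, ← hB, hβψ, hβψ, hφ'rel, hφ'rel]
    · intro p
      obtain ⟨⟨i, x⟩, rfl⟩ := ψ.surjective p
      simp only [Equiv.symm_apply_apply]
      exact (hψrel i x).symm
    · intro i
      simp
  rw [hQ, ← Equiv.Perm.sign_eq_neg_one_pow_orbits, ← hsβ, ← hφ.sign_reversal,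
    ← hψ.sign_reversal]
  have h3 : φ.trans ψ.symm = ((reversal φ s).symm.trans β).trans (reversal ψ s) := by
    ext1 p
    simp [hβ, hφ', hψ']
  have h4 : Equiv.Perm.sign (φ.trans ψ.symm) = Equiv.Perm.sign (reversal ψ s) *
      (Equiv.Perm.sign β * Equiv.Perm.sign (reversal φ s)) := by
    rw [h3, Equiv.Perm.sign_trans, Equiv.Perm.sign_trans, Equiv.Perm.sign_symm]
  rw [h4]
  have h6 : ((Equiv.Perm.sign β : ℤˣ) : ℤ) * (Equiv.Perm.sign β : ℤˣ) = 1 := by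
    rw [← Units.val_mul, Int.units_mul_self, Units.val_one]
  push_cast
  linear_combination (-(Equiv.Perm.sign (reversal φ s) : ℤ) *
    (Equiv.Perm.sign (reversal ψ s) : ℤ)) * h6

/-- The number of common proper colourings of two matchings is `2` to the number of closed
curves they form. -/
theorem card_isProper [Finite X] (φ ψ : I × Bool ≃ X) :
    Nat.card {s : X → Bool // IsProper φ s ∧ IsProper ψ s} =
      2 ^ Nat.card (Quot (MatchRel φ ψ)) := by
  classical
  let inv : (I × Bool ≃ X) → Equiv.Perm X := fun χ =>
    χ.permCongr (Equiv.prodCongrRight fun _ => Equiv.swap false true)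
  have hinv : ∀ χ i x, inv χ (χ (i, x)) = χ (i, !x) := by
    intro χ i x
    simp only [inv, Equiv.permCongr_apply, Equiv.symm_apply_apply, Equiv.prodCongrRight_apply]
    cases x <;> simp
  have hinv2 : ∀ χ p, inv χ (inv χ p) = p := by
    intro χ p
    obtain ⟨⟨i, x⟩, rfl⟩ := χ.surjective p
    rw [hinv, hinv, Bool.not_not]
  have hinv3 : ∀ χ p, inv χ p ≠ p := by
    intro χ p
    obtain ⟨⟨i, x⟩, rfl⟩ := χ.surjective p
    rw [hinv, Ne, EmbeddingLike.apply_eq_iff_eq]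
    simp
  obtain ⟨s₀, hs₀⟩ := exists_bool_coloring (inv φ) (inv ψ) (hinv2 φ) (hinv2 ψ) (hinv3 φ) (hinv3 ψ)
  have h0φ : IsProper φ s₀ := fun i => by
    have := (hs₀ (φ (i, false))).1
    rwa [hinv] at this
  have h0ψ : IsProper ψ s₀ := fun i => by
    have := (hs₀ (ψ (i, false))).2
    rwa [hinv] at this
  -- Two proper colourings differ by a function constant along each curve, so one base colouring
  -- `s₀` identifies all of them with functions on the curves.
  have e : {s : X → Bool // IsProper φ s ∧ IsProper ψ s} ≃ (Quot (MatchRel φ ψ) → Bool) :=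
    { toFun := fun s => Quot.lift (fun p => xor (s.1 p) (s₀ p)) (by
        rintro _ _ (⟨i, rfl, rfl⟩ | ⟨i, rfl, rfl⟩)
        · simp [s.2.1 i, h0φ i]
        · simp [s.2.2 i, h0ψ i])
      invFun := fun c => ⟨fun p => xor (c (Quot.mk _ p)) (s₀ p), by
        refine ⟨fun i => ?_, fun i => ?_⟩
        · have : Quot.mk (MatchRel φ ψ) (φ (i, false)) = Quot.mk _ (φ (i, true)) :=
            Quot.sound (Or.inl ⟨i, rfl, rfl⟩)
          simp [this, h0φ i]
        · have : Quot.mk (MatchRel φ ψ) (ψ (i, false)) = Quot.mk _ (ψ (i, true)) :=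
            Quot.sound (Or.inr ⟨i, rfl, rfl⟩)
          simp [this, h0ψ i]⟩
      left_inv := fun s => by ext p; simp
      right_inv := fun c => by ext ⟨p⟩; simp }
  rw [Nat.card_congr e, Nat.card_fun]
  simp

/-- The loop value `-2`: the contraction of the alternating forms along two matchings. -/
theorem sum_prod_boolAlt [Fintype I] [DecidableEq I] [Fintype X] [DecidableEq X]
    (φ ψ : I × Bool ≃ X) :
    ∑ s : X → Bool, (∏ i, boolAlt (s (φ (i, false))) (s (φ (i, true)))) *
      ∏ i, boolAlt (s (ψ (i, false))) (s (ψ (i, true))) =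
    Equiv.Perm.sign (φ.trans ψ.symm) * (-1) ^ Fintype.card I *
      (-2) ^ Nat.card (Quot (MatchRel φ ψ)) := by
  classical
  have h1 : ∀ s : X → Bool, (∏ i, boolAlt (s (φ (i, false))) (s (φ (i, true)))) *
      ∏ i, boolAlt (s (ψ (i, false))) (s (ψ (i, true))) =
      if IsProper φ s ∧ IsProper ψ s then (Equiv.Perm.sign (φ.trans ψ.symm) : ℤ) *
        (-1) ^ (Fintype.card I + Nat.card (Quot (MatchRel φ ψ))) else 0 := by
    intro s
    split_ifs with h
    · exact h.1.prod_boolAlt h.2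
    · rcases not_and_or.mp h with h | h
      · rw [prod_boolAlt_eq_zero h, zero_mul]
      · rw [prod_boolAlt_eq_zero h, mul_zero]
  rw [Finset.sum_congr rfl fun s _ => h1 s, ← Finset.sum_filter, Finset.sum_const,
    ← Fintype.card_subtype, ← Nat.card_eq_fintype_card, card_isProper, nsmul_eq_mul, pow_add,
    show (-2 : ℤ) = 2 * (-1) by norm_num, mul_pow]
  push_cast
  ring

end Matchings

/-! ### Factorial estimates for the binomial distribution -/

/-- In the form `p ^ j / j! ≤ p ^ p / p!`, this says that the Poisson weights of mean `p` are
maximal at `j = p`. -/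
theorem Nat.factorial_mul_self_pow_le (p j : ℕ) : p.factorial * p ^ j ≤ p ^ p * j.factorial := by
  rcases le_total p j with h | h
  · obtain ⟨d, rfl⟩ := Nat.exists_eq_add_of_le h
    have := Nat.factorial_mul_pow_le_factorial (m := p) (n := d)
    calc p.factorial * p ^ (p + d) = p ^ p * (p.factorial * p ^ d) := by ring
      _ ≤ p ^ p * (p.factorial * (p + 1) ^ d) := by gcongr; omega
      _ ≤ _ := by gcongr
  · obtain ⟨d, rfl⟩ := Nat.exists_eq_add_of_le h
    have h1 : (j + d).factorial ≤ j.factorial * (j + d) ^ d := by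
      have := Nat.factorial_mul_descFactorial (Nat.le_add_left d j)
      rw [Nat.add_sub_cancel] at this
      rw [← this]
      gcongr
      exact Nat.descFactorial_le_pow _ _
    calc (j + d).factorial * (j + d) ^ j ≤ j.factorial * (j + d) ^ d * (j + d) ^ j := by gcongr
      _ = _ := by rw [pow_add]; ring

/-- The mode of the binomial distribution with parameters `c` and `p / c` is `p`. -/
theorem Nat.factorial_mul_factorial_mul_pow_le {c p : ℕ} (h : p ≤ c) :
    p.factorial * (c - p).factorial * c ^ c ≤
      (c + 1) * c.factorial * (p ^ p * (c - p) ^ (c - p)) := by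
  have h1 : c ^ c = ∑ j ∈ Finset.range (c + 1), p ^ j * (c - p) ^ (c - j) * c.choose j := by
    have := add_pow p (c - p) c
    simpa only [Nat.add_sub_cancel' h, Nat.cast_id] using this
  rw [h1, Finset.mul_sum]
  calc _ ≤ ∑ j ∈ Finset.range (c + 1), c.factorial * (p ^ p * (c - p) ^ (c - p)) := by
        -- Each of the `c + 1` terms in the expansion of `(p + (c - p)) ^ c` is at most the term `j
        -- = p`.
        refine Finset.sum_le_sum fun j hj => ?_
        have hj' : j ≤ c := Nat.lt_succ_iff.mp (Finset.mem_range.mp hj)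
        calc _ = (p.factorial * p ^ j) * ((c - p).factorial * (c - p) ^ (c - j)) * c.choose j := by
              ring
          _ ≤ (p ^ p * j.factorial) * ((c - p) ^ (c - p) * (c - j).factorial) * c.choose j := by
              exact Nat.mul_le_mul_right _ (Nat.mul_le_mul (Nat.factorial_mul_self_pow_le _ _)
                (Nat.factorial_mul_self_pow_le _ _))
          _ = (c.choose j * j.factorial * (c - j).factorial) * (p ^ p * (c - p) ^ (c - p)) := by
              ring
          _ = _ := by rw [Nat.choose_mul_factorial_mul_factorial hj']
    _ = _ := by rw [Finset.sum_const, Finset.card_range, smul_eq_mul, mul_assoc]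

/-! ### The antisymmetrizer as a combination of powers of unit vectors -/

/-- The number of places of colour `true`. -/
def countTrue {c : ℕ} (S : Fin c → Bool) : ℕ := (Finset.univ.filter fun i => S i = true).card

theorem countTrue_le {c : ℕ} (S : Fin c → Bool) : countTrue S ≤ c :=
  (Finset.card_le_univ _).trans_eq (Fintype.card_fin c)

theorem countTrue_add_not {c : ℕ} (S : Fin c → Bool) :
    countTrue S + countTrue (fun i => !S i) = c := by
  have := Finset.card_filter_add_card_filter_not (s := (Finset.univ : Finset (Fin c)))
    (fun i => S i = true)
  simpa [countTrue] using this

theorem prod_apply_eq_pow_countTrue {c : ℕ} (S : Fin c → Bool) (u : Bool → ℂ) :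
    ∏ i, u (S i) = u true ^ countTrue S * u false ^ (c - countTrue S) := by
  have h : c - countTrue S = countTrue (fun i => !S i) := by
    have := countTrue_add_not S; omega
  rw [h, countTrue, countTrue, ← Finset.prod_const, ← Finset.prod_const, Finset.prod_filter,
    Finset.prod_filter, ← Finset.prod_mul_distrib]
  refine Finset.prod_congr rfl fun i _ => ?_
  cases S i <;> simp

/-- The number of permutations carrying a colouring to another one. -/
theorem card_perm_comp_eq {c : ℕ} (S T : Fin c → Bool) :
    Fintype.card {τ : Equiv.Perm (Fin c) // T ∘ τ = S} =
      if countTrue T = countTrue S then (countTrue S).factorial * (c - countTrue S).factorial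
      else 0 := by
  have hcard : ∀ (R : Fin c → Bool) (x : Bool), Fintype.card {i // R i = x} =
      if x then countTrue R else c - countTrue R := by
    intro R x
    cases x
    · have := countTrue_add_not R
      rw [if_neg (by simp), Fintype.card_subtype]
      simp only [countTrue, Bool.not_eq_true'] at this ⊢
      omega
    · simp [countTrue, Fintype.card_subtype]
  split_ifs with h
  -- Fibres of equal size give one solution `τ₀`; the solutions form a coset of the stabilizer of
  -- `S`.
  · let τ₀ : Equiv.Perm (Fin c) := Equiv.ofFiberEquiv (f := S) (g := T) fun x =>
      Fintype.equivOfCardEq (by rw [hcard, hcard, h])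
    have hτ₀ : ∀ i, T (τ₀ i) = S i := fun i => Equiv.ofFiberEquiv_map _ i
    have e : {τ : Equiv.Perm (Fin c) // T ∘ τ = S} ≃ {g : Equiv.Perm (Fin c) // S ∘ g = S} :=
      (Equiv.mulLeft τ₀⁻¹).subtypeEquiv fun τ => by
        simp only [funext_iff, Function.comp_apply, Equiv.coe_mulLeft, Equiv.Perm.mul_apply]
        refine forall_congr' fun i => ?_
        rw [← hτ₀ (τ₀⁻¹ (τ i))]
        simp
    rw [Fintype.card_congr e, DomMulAct.stabilizer_card, Fintype.prod_bool, hcard, hcard]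
    simp
  · rw [Fintype.card_eq_zero_iff]
    refine ⟨fun ⟨τ, hτ⟩ => h ?_⟩
    subst hτ
    simp only [countTrue, Function.comp_apply]
    refine Finset.card_bij (fun i _ => τ.symm i) ?_ ?_ ?_
    · intro i hi; simpa using hi
    · intro i _ j _ hij; simpa using hij
    · intro i hi; exact ⟨τ i, by simpa using hi, by simp⟩

/-- The contraction of the antisymmetrizer with two colourings of its ends. -/
theorem sum_perm_prod_boolAlt {c : ℕ} (S T : Fin c → Bool) :
    ∑ τ : Equiv.Perm (Fin c), ∏ i, boolAlt (S i) (T (τ i)) =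
      if countTrue T = c - countTrue S then
        (-1) ^ countTrue S * ((countTrue S).factorial * (c - countTrue S).factorial : ℤ)
      else 0 := by
  have h1 : ∀ τ : Equiv.Perm (Fin c), ∏ i, boolAlt (S i) (T (τ i)) =
      if T ∘ τ = (fun i => !S i) then (-1) ^ countTrue S else 0 := by
    intro τ
    split_ifs with h
    · rw [countTrue, ← Finset.prod_const, Finset.prod_filter]
      refine Finset.prod_congr rfl fun i _ => ?_
      rw [show T (τ i) = !S i from congrFun h i, boolAlt]
      cases S i <;> simp
    · obtain ⟨i, hi⟩ := Function.ne_iff.mp h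
      refine Finset.prod_eq_zero (Finset.mem_univ i) ?_
      rw [boolAlt, if_pos]
      revert hi
      simp only [Function.comp_apply]
      cases S i <;> cases T (τ i) <;> simp
  have h2 : countTrue (fun i => !S i) = c - countTrue S := by
    have := countTrue_add_not S; omega
  rw [Finset.sum_congr rfl fun τ _ => h1 τ, ← Finset.sum_filter, Finset.sum_const,
    ← Fintype.card_subtype, card_perm_comp_eq, h2, Nat.sub_sub_self (countTrue_le S)]
  split_ifs
  · rw [nsmul_eq_mul]; push_cast; ring
  · simp

/-- Orthogonality of the characters `k ↦ ζ ^ (k * j)` for `0 ≤ j ≤ c`. -/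
theorem IsPrimitiveRoot.sum_pow_mul_inv_pow {c : ℕ} {ζ : ℂ} (hζ : IsPrimitiveRoot ζ (c + 1))
    {j p : ℕ} (hj : j ≤ c) (hp : p ≤ c) :
    ∑ k : Fin (c + 1), (ζ ^ (k : ℕ)) ^ j * ((ζ ^ (k : ℕ)) ^ p)⁻¹ =
      if j = p then (c : ℂ) + 1 else 0 := by
  have hne : ζ ≠ 0 := hζ.ne_zero (by omega)
  have h1 : ∀ k : Fin (c + 1), (ζ ^ (k : ℕ)) ^ j * ((ζ ^ (k : ℕ)) ^ p)⁻¹ =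
      (ζ ^ j / ζ ^ p) ^ (k : ℕ) := by
    intro k
    rw [div_pow, ← pow_mul, ← pow_mul, ← pow_mul, ← pow_mul, div_eq_mul_inv, mul_comm j,
      mul_comm p]
  rw [Finset.sum_congr rfl fun k _ => h1 k,
    Fin.sum_univ_eq_sum_range (fun k => (ζ ^ j / ζ ^ p) ^ k) (c + 1)]
  split_ifs with h
  · subst h
    simp [div_self (pow_ne_zero j hne)]
  · have h2 : ζ ^ j / ζ ^ p ≠ 1 := by
      rw [Ne, div_eq_one_iff_eq (pow_ne_zero p hne)]
      exact fun h3 => h (hζ.pow_inj (by omega) (by omega) h3)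
    have h3 := geom_sum_mul (ζ ^ j / ζ ^ p) (c + 1)
    have h4 : (ζ ^ j / ζ ^ p) ^ (c + 1) = 1 := by
      rw [div_pow, ← pow_mul, ← pow_mul, mul_comm j, mul_comm p, pow_mul, pow_mul, hζ.pow_eq_one]
      simp
    rw [h4, sub_self] at h3
    exact (mul_eq_zero.mp h3).resolve_right (sub_ne_zero.mpr h2)

/-- A state vector with prescribed moduli and relative phase. -/
def phaseVector (r s ω : ℂ) (x : Bool) : ℂ := if x then r * ω else s

/-- The colourings with `p` places of colour `true` are singled out by averaging over phases. -/
theorem sum_prod_phaseVector {c : ℕ} {ζ : ℂ} (hζ : IsPrimitiveRoot ζ (c + 1)) {p : ℕ} (hp : p ≤ c)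
    (r s : ℂ) (S : Fin c → Bool) :
    ∑ k : Fin (c + 1), ((c : ℂ) + 1)⁻¹ * ((ζ ^ (k : ℕ)) ^ p)⁻¹ *
        ∏ i, phaseVector r s (ζ ^ (k : ℕ)) (S i) =
      if countTrue S = p then r ^ p * s ^ (c - p) else 0 := by
  have h1 : ∀ k : Fin (c + 1), ((c : ℂ) + 1)⁻¹ * ((ζ ^ (k : ℕ)) ^ p)⁻¹ *
        ∏ i, phaseVector r s (ζ ^ (k : ℕ)) (S i) =
      (((c : ℂ) + 1)⁻¹ * (r ^ countTrue S * s ^ (c - countTrue S))) *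
        ((ζ ^ (k : ℕ)) ^ countTrue S * ((ζ ^ (k : ℕ)) ^ p)⁻¹) := by
    intro k
    rw [prod_apply_eq_pow_countTrue]
    simp only [phaseVector, if_true, Bool.false_eq_true, if_false, mul_pow]
    ring
  rw [Finset.sum_congr rfl fun k _ => h1 k, ← Finset.mul_sum,
    hζ.sum_pow_mul_inv_pow (countTrue_le S) hp]
  have hc : (c : ℂ) + 1 ≠ 0 := Nat.cast_add_one_ne_zero c
  split_ifs with h
  · rw [h]; field_simp
  · simp

theorem norm_phaseVector_sq {r s : ℝ} {ω : ℂ} (hω : ‖ω‖ = 1) (h : r ^ 2 + s ^ 2 = 1) :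
    ‖phaseVector r s ω false‖ ^ 2 + ‖phaseVector r s ω true‖ ^ 2 = 1 := by
  simp [phaseVector, hω]
  linarith

/-- The antisymmetrizer on `c` strands is a combination of `c`-th powers of pairs of unit vectors,
with coefficients of total size at most `(c + 1) ^ 2 * c !`. -/
theorem exists_antisymmetrizer_decomposition {c : ℕ} (hc : 0 < c) :
    ∃ (coef : Fin (c + 1) × Fin (c + 1) × Fin (c + 1) → ℂ)
      (u v : Fin (c + 1) × Fin (c + 1) × Fin (c + 1) → Bool → ℂ),
      (∀ l, ‖u l false‖ ^ 2 + ‖u l true‖ ^ 2 = 1) ∧ (∀ l, ‖v l false‖ ^ 2 + ‖v l true‖ ^ 2 = 1) ∧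
      ∑ l, ‖coef l‖ ≤ ((c : ℝ) + 1) ^ 2 * c.factorial ∧
      ∀ S T : Fin c → Bool,
        ∑ τ : Equiv.Perm (Fin c), ∏ i, (boolAlt (S i) (T (τ i)) : ℂ) =
          ∑ l, coef l * ((∏ i, u l (S i)) * ∏ i, v l (T i)) := by
  obtain ⟨ζ, hζ⟩ : ∃ ζ : ℂ, IsPrimitiveRoot ζ (c + 1) :=
    ⟨_, Complex.isPrimitiveRoot_exp (c + 1) (by omega)⟩
  have hζn : ∀ k : ℕ, ‖ζ ^ k‖ = 1 := fun k => by
    rw [norm_pow, hζ.norm'_eq_one (by omega), one_pow]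
  have hc' : (0 : ℝ) < c := by exact_mod_cast hc
  -- Among `r² + s² = 1`, the value `r² = p / c` maximizes `r ^ p * s ^ (c - p)`, which keeps the
  -- coefficients small.
  let r : ℕ → ℝ := fun p => √((p : ℝ) / c)
  let s : ℕ → ℝ := fun p => √(((c - p : ℕ) : ℝ) / c)
  have hr2 : ∀ p, r p ^ 2 = (p : ℝ) / c := fun p => Real.sq_sqrt (by positivity)
  have hs2 : ∀ p, s p ^ 2 = ((c - p : ℕ) : ℝ) / c := fun p => Real.sq_sqrt (by positivity)
  have hrs : ∀ p ≤ c, r p ^ 2 + s p ^ 2 = 1 := fun p hp => by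
    rw [hr2, hs2, Nat.cast_sub hp]; field_simp; ring
  let w : ℕ → ℝ := fun p => r p ^ p * s p ^ (c - p)
  have hw2 : ∀ p ≤ c, w p ^ 2 * (c : ℝ) ^ c = (p : ℝ) ^ p * ((c - p : ℕ) : ℝ) ^ (c - p) := by
    intro p hp
    simp only [w]
    rw [mul_pow, ← pow_mul, ← pow_mul, mul_comm p, mul_comm (c - p), pow_mul, pow_mul, hr2, hs2,
      div_pow, div_pow]
    have : (c : ℝ) ^ c = (c : ℝ) ^ p * (c : ℝ) ^ (c - p) := by
      rw [← pow_add, Nat.add_sub_cancel' hp]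
    rw [this]
    field_simp
  have hwpos : ∀ p ≤ c, 0 < w p ^ 2 := by
    intro p hp
    have h1 : (0 : ℝ) < (p : ℝ) ^ p * ((c - p : ℕ) : ℝ) ^ (c - p) := by
      -- The extreme cases `p = 0` and `p = c` rely on `0 ^ 0 = 1`.
      have h2 : ∀ q : ℕ, (0 : ℝ) < (q : ℝ) ^ q := fun q => by
        rcases Nat.eq_zero_or_pos q with rfl | h
        · simp
        · positivity
      exact mul_pos (h2 _) (h2 _)
    rw [← hw2 p hp] at h1
    exact pos_of_mul_pos_left h1 (by positivity)
  -- The contraction is `± p! (c - p)!` when `S` has `p` places `true` and `T` has `c - p`. Both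
  -- products of vectors contribute `w p`, hence the division by its square.
  let a : ℕ → ℝ := fun p => p.factorial * (c - p).factorial / w p ^ 2
  have ha : ∀ p ≤ c, a p ≤ ((c : ℝ) + 1) * c.factorial := by
    intro p hp
    rw [div_le_iff₀ (hwpos p hp)]
    have h1 : ((p.factorial * (c - p).factorial * c ^ c : ℕ) : ℝ) ≤
      ((c + 1) * c.factorial * (p ^ p * (c - p) ^ (c - p)) : ℕ) := by
      exact_mod_cast Nat.factorial_mul_factorial_mul_pow_le hp
    rw [Nat.cast_mul, Nat.cast_mul ((c + 1) * c.factorial), Nat.cast_mul (p ^ p), Nat.cast_pow,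
      Nat.cast_pow, Nat.cast_pow, ← hw2 p hp, ← mul_assoc] at h1
    have h2 := le_of_mul_le_mul_right h1 (by positivity)
    push_cast at h2
    exact h2
  have ha0 : ∀ p, 0 ≤ a p := fun p => by positivity
  have hlt : ∀ l : Fin (c + 1), (l : ℕ) ≤ c := fun l => Nat.lt_succ_iff.mp l.2
  refine ⟨fun l => (-1) ^ (l.1 : ℕ) * a l.1 *
      ((((c : ℂ) + 1)⁻¹ * ((ζ ^ (l.2.1 : ℕ)) ^ (l.1 : ℕ))⁻¹) *
        (((c : ℂ) + 1)⁻¹ * ((ζ ^ (l.2.2 : ℕ)) ^ (c - (l.1 : ℕ)))⁻¹)),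
    fun l => phaseVector (r l.1) (s l.1) (ζ ^ (l.2.1 : ℕ)),
    fun l => phaseVector (s l.1) (r l.1) (ζ ^ (l.2.2 : ℕ)), ?_, ?_, ?_, ?_⟩
  · exact fun l => norm_phaseVector_sq (hζn _) (hrs _ (hlt _))
  · exact fun l => norm_phaseVector_sq (hζn _) (by rw [add_comm]; exact hrs _ (hlt _))
  -- There are `(c + 1) ^ 3` terms, each at most `(c + 1) * c!` divided by `(c + 1) ^ 2`.
  · have h1 : ‖(c : ℂ) + 1‖ = (c : ℝ) + 1 := by
      rw [← Nat.cast_add_one, Complex.norm_natCast]; push_cast; rfl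
    have h2 : ∀ l : Fin (c + 1) × Fin (c + 1) × Fin (c + 1), ‖(-1) ^ (l.1 : ℕ) * (a l.1 : ℂ) *
      ((((c : ℂ) + 1)⁻¹ * ((ζ ^ (l.2.1 : ℕ)) ^ (l.1 : ℕ))⁻¹) *
        (((c : ℂ) + 1)⁻¹ * ((ζ ^ (l.2.2 : ℕ)) ^ (c - (l.1 : ℕ)))⁻¹))‖ ≤
        ((c : ℝ) + 1) * c.factorial * (((c : ℝ) + 1)⁻¹ * ((c : ℝ) + 1)⁻¹) := by
      intro l
      simp only [norm_mul, norm_inv, h1, norm_pow _ (c - (l.1 : ℕ)), norm_pow _ (l.1 : ℕ), hζn,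
        norm_neg, norm_one, one_pow, inv_one, mul_one, one_mul, Complex.norm_real,
        Real.norm_eq_abs, abs_of_nonneg (ha0 _)]
      gcongr
      exact ha _ (hlt _)
    refine (Finset.sum_le_sum fun l _ => h2 l).trans (le_of_eq ?_)
    rw [Finset.sum_const, Finset.card_univ]
    simp only [Fintype.card_prod, Fintype.card_fin, nsmul_eq_mul]
    push_cast
    field_simp
  · intro S T
    have h1 : ∑ τ : Equiv.Perm (Fin c), ∏ i, (boolAlt (S i) (T (τ i)) : ℂ) =
        ((∑ τ : Equiv.Perm (Fin c), ∏ i, boolAlt (S i) (T (τ i)) : ℤ) : ℂ) := by push_cast; rfl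
    rw [h1, sum_perm_prod_boolAlt, Fintype.sum_prod_type]
    have h2 : ∀ p : Fin (c + 1), ∑ l : Fin (c + 1) × Fin (c + 1), (-1) ^ (p : ℕ) * (a p : ℂ) *
      ((((c : ℂ) + 1)⁻¹ * ((ζ ^ (l.1 : ℕ)) ^ (p : ℕ))⁻¹) *
        (((c : ℂ) + 1)⁻¹ * ((ζ ^ (l.2 : ℕ)) ^ (c - (p : ℕ)))⁻¹)) *
        ((∏ i, phaseVector (r p) (s p) (ζ ^ (l.1 : ℕ)) (S i)) *
          ∏ i, phaseVector (s p) (r p) (ζ ^ (l.2 : ℕ)) (T i)) =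
        if (p : ℕ) = countTrue S then (if countTrue T = c - countTrue S then
          (-1) ^ countTrue S * ((countTrue S).factorial * (c - countTrue S).factorial : ℂ) else 0)
        else 0 := by
      intro p
      have h3 := sum_prod_phaseVector hζ (hlt p) (r p) (s p) S
      have h4 := sum_prod_phaseVector hζ (Nat.sub_le c p) (s p) (r p) T
      rw [Nat.sub_sub_self (hlt p)] at h4
      rw [Fintype.sum_prod_type]
      have h5 : ∀ x y : Fin (c + 1), (-1) ^ (p : ℕ) * (a p : ℂ) *
          ((((c : ℂ) + 1)⁻¹ * ((ζ ^ (x : ℕ)) ^ (p : ℕ))⁻¹) *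
          (((c : ℂ) + 1)⁻¹ * ((ζ ^ (y : ℕ)) ^ (c - (p : ℕ)))⁻¹)) *
          ((∏ i, phaseVector (r p) (s p) (ζ ^ (x : ℕ)) (S i)) *
            ∏ i, phaseVector (s p) (r p) (ζ ^ (y : ℕ)) (T i)) =
          (-1) ^ (p : ℕ) * (a p : ℂ) * ((((c : ℂ) + 1)⁻¹ * ((ζ ^ (x : ℕ)) ^ (p : ℕ))⁻¹ *
            ∏ i, phaseVector (r p) (s p) (ζ ^ (x : ℕ)) (S i)) *
            (((c : ℂ) + 1)⁻¹ * ((ζ ^ (y : ℕ)) ^ (c - (p : ℕ)))⁻¹ *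
            ∏ i, phaseVector (s p) (r p) (ζ ^ (y : ℕ)) (T i))) := by
        intro x y; ring
      simp only [h5, ← Finset.mul_sum, ← Finset.sum_mul]
      rw [h3, h4]
      by_cases hpS : (p : ℕ) = countTrue S
      · rw [if_pos hpS, if_pos hpS.symm, ← hpS]
        by_cases hT : countTrue T = c - p
        · rw [if_pos hT, if_pos hT]
          have h6 : (a p : ℂ) * ((r p : ℂ) ^ (p : ℕ) * (s p : ℂ) ^ (c - (p : ℕ)) *
              ((s p : ℂ) ^ (c - (p : ℕ)) * (r p : ℂ) ^ (p : ℕ))) =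
              ((p : ℕ).factorial * (c - p).factorial : ℂ) := by
            have h7 : a p * (w p ^ 2) = ((p : ℕ).factorial * (c - p).factorial : ℝ) :=
              div_mul_cancel₀ _ (hwpos p (hlt p)).ne'
            have h8 := congrArg (fun x : ℝ => (x : ℂ)) h7
            simp only [w] at h8
            push_cast at h8
            rw [← h8]; ring
          rw [mul_assoc, h6]
        · rw [if_neg hT, if_neg hT, mul_zero, mul_zero]
      · rw [if_neg hpS, if_neg (Ne.symm hpS), zero_mul, mul_zero]
    rw [Finset.sum_congr rfl fun p _ => h2 p]
    have h9 : countTrue S < c + 1 := Nat.lt_succ_of_le (countTrue_le S)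
    rw [Finset.sum_eq_single (⟨countTrue S, h9⟩ : Fin (c + 1))]
    · simp only [if_true]
      split_ifs <;> push_cast <;> rfl
    · intro p _ hp
      rw [if_neg]
      exact fun h => hp (Fin.ext h)
    · simp

/-! ### Three unit vectors and the geometry of the sphere -/

/-- The contraction of two state vectors with the alternating form. -/
def altForm (u v : Bool → ℂ) : ℂ := u false * v true - u true * v false

/-- The squared norm of the contraction in terms of the corresponding points of the sphere. -/
theorem two_mul_normSq_altForm (u v : Bool → ℂ) :
    2 * Complex.normSq (altForm u v) =
      (Complex.normSq (u false) + Complex.normSq (u true)) *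
        (Complex.normSq (v false) + Complex.normSq (v true)) -
      ((Complex.normSq (u false) - Complex.normSq (u true)) *
        (Complex.normSq (v false) - Complex.normSq (v true)) +
      4 * (u false * star (u true)).re * (v false * star (v true)).re +
      4 * (u false * star (u true)).im * (v false * star (v true)).im) := by
  simp only [altForm, Complex.normSq_apply, Complex.mul_re, Complex.mul_im, Complex.sub_re,
    Complex.sub_im, Complex.star_def, Complex.conj_re, Complex.conj_im]
  ring

/-- The inequality of arithmetic and geometric means, with mean `3/4`. -/
theorem mul_mul_le_of_add_le {x y z : ℝ} (hx : 0 ≤ x) (hy : 0 ≤ y) (hz : 0 ≤ z)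
    (h : x + y + z ≤ 9 / 4) : x * y * z ≤ 27 / 64 := by
  have h1 : 27 * (x * y * z) ≤ (x + y + z) ^ 3 := by
    nlinarith [mul_nonneg hx (sq_nonneg (y - z)), mul_nonneg hy (sq_nonneg (x - z)),
      mul_nonneg hz (sq_nonneg (x - y)), mul_nonneg (add_nonneg (add_nonneg hx hy) hz)
      (add_nonneg (add_nonneg (sq_nonneg (x - y)) (sq_nonneg (y - z))) (sq_nonneg (x - z)))]
  have h2 : (x + y + z) ^ 3 ≤ (9 / 4) ^ 3 := by gcongr
  linarith

/-- The product of the mutual contractions of three unit vectors in `ℂ²` is largest for an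
equilateral triangle on a great circle of the sphere. -/
theorem prod_norm_altForm_le (u : Fin 3 → Bool → ℂ)
    (hu : ∀ k, ‖u k false‖ ^ 2 + ‖u k true‖ ^ 2 = 1) :
    ∏ k, ‖altForm (u k) (u (k + 1))‖ ≤ √(27 / 64) := by
  apply Real.le_sqrt_of_sq_le
  rw [← Finset.prod_pow, Fin.prod_univ_three]
  simp only [← Complex.normSq_eq_norm_sq] at hu ⊢
  refine mul_mul_le_of_add_le (Complex.normSq_nonneg _) (Complex.normSq_nonneg _)
    (Complex.normSq_nonneg _) ?_
  have e1 := two_mul_normSq_altForm (u 0) (u (0 + 1))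
  have e2 := two_mul_normSq_altForm (u 1) (u (1 + 1))
  have e3 := two_mul_normSq_altForm (u 2) (u (2 + 1))
  rw [hu, hu] at e1 e2 e3
  simp only [show (0 : Fin 3) + 1 = 1 from rfl, show (1 : Fin 3) + 1 = 2 from rfl,
    show (2 : Fin 3) + 1 = 0 from rfl] at *
  -- The point of the sphere attached to a unit vector has length one.
  have key : ∀ k, (Complex.normSq (u k false) - Complex.normSq (u k true)) ^ 2 +
      4 * (u k false * star (u k true)).re ^ 2 + 4 * (u k false * star (u k true)).im ^ 2 = 1 := by
    intro k
    have h1 : Complex.normSq (u k false * star (u k true)) =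
        Complex.normSq (u k false) * Complex.normSq (u k true) := by
      rw [Complex.normSq_mul, Complex.star_def, Complex.normSq_conj]
    rw [Complex.normSq_apply (u k false * star (u k true))] at h1
    have h2 := hu k
    have h3 : (Complex.normSq (u k false) + Complex.normSq (u k true)) ^ 2 = 1 := by
      rw [h2, one_pow]
    linear_combination 4 * h1 + h3
  have k0 := key 0
  have k1 := key 1
  have k2 := key 2
  generalize hα : (fun k => Complex.normSq (u k false) - Complex.normSq (u k true)) = α
  generalize hβ : (fun k => (u k false * star (u k true)).re) = β
  generalize hγ : (fun k => (u k false * star (u k true)).im) = γ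
  simp only [funext_iff] at hα hβ hγ
  simp only [hα, hβ, hγ] at e1 e2 e3 k0 k1 k2
  -- The sum of the three points has nonnegative squared length, so their pairwise inner products
  -- add up to at least `-3/2`, and the squared contractions to at most `(3 + 3/2) / 2 = 9/4`.
  linarith [sq_nonneg (α 0 + α 1 + α 2), sq_nonneg (β 0 + β 1 + β 2),
    sq_nonneg (γ 0 + γ 1 + γ 2)]

/-- Contraction of a product of state vectors along a matching. -/
theorem sum_prod_boolAlt_mul_prod {A X : Type*} [Fintype A] [DecidableEq A] [Fintype X]
    [DecidableEq X] (φ : A × Bool ≃ X) (U : X → Bool → ℂ) :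
    ∑ s : X → Bool, (∏ a, (boolAlt (s (φ (a, false))) (s (φ (a, true))) : ℂ)) * ∏ x, U x (s x) =
      ∏ a, altForm (U (φ (a, false))) (U (φ (a, true))) := by
  have h1 : ∀ a, altForm (U (φ (a, false))) (U (φ (a, true))) =
      ∑ t : Bool → Bool, (boolAlt (t false) (t true) : ℂ) *
        (U (φ (a, false)) (t false) * U (φ (a, true)) (t true)) := by
    intro a
    have h := Fintype.sum_equiv (Equiv.boolArrowEquivProd Bool)
      (fun t : Bool → Bool => (boolAlt (t false) (t true) : ℂ) *
        (U (φ (a, false)) (t false) * U (φ (a, true)) (t true)))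
      (fun t : Bool × Bool => (boolAlt t.1 t.2 : ℂ) *
        (U (φ (a, false)) t.1 * U (φ (a, true)) t.2)) (fun t => rfl)
    rw [h, Fintype.sum_prod_type]
    simp [altForm, boolAlt]
    ring
  rw [Finset.prod_congr rfl fun a _ => h1 a, Finset.prod_univ_sum, Fintype.piFinset_univ]
  refine Fintype.sum_equiv ((Equiv.arrowCongr φ.symm (Equiv.refl Bool)).trans
    (Equiv.curry A Bool Bool)) _ _ fun s => ?_
  have h2 : ∏ x, U x (s x) = ∏ a, (U (φ (a, false)) (s (φ (a, false))) *
      U (φ (a, true)) (s (φ (a, true)))) := by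
    rw [← φ.prod_comp, Fintype.prod_prod_type]
    refine Finset.prod_congr rfl fun a _ => ?_
    rw [Fintype.prod_bool, mul_comm]
  rw [h2, ← Finset.prod_mul_distrib]
  rfl

/-! ### The Penrose evaluation in uniform decoration as a contraction -/

namespace CubicRibbonGraph

section Uniform

variable (G : CubicRibbonGraph.{u}) (n : ℕ)

theorem halfEdge_injective : Function.Injective fun p : G.Vert × Fin 3 => G.halfEdge p.1 p.2 := by
  intro p q h
  apply G.attach.injective
  simp only [halfEdge, Prod.mk.injEq, Sum.inl.injEq] at h
  exact Prod.ext h.1 h.2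

theorem exists_halfEdge_eq [IsEmpty G.Triv] (h : G.Edge × Bool) :
    ∃ v k, G.halfEdge v k = h := by
  obtain ⟨e | t, b⟩ := h
  · refine ⟨(G.attach.symm (e, b)).1, (G.attach.symm (e, b)).2, ?_⟩
    simp [halfEdge]
  · exact isEmptyElim t

theorem card_vert_mul_three [IsEmpty G.Triv] :
    Fintype.card G.Vert * 3 = Fintype.card G.Edge * 2 := by
  have := Fintype.card_congr G.attach
  simpa using this

/-- The ends of the arc number `a.2.2` between the slots `a.2.1` and `a.2.1 + 1` of the vertex
`a.1`, in the uniform decoration by `2 * n`. -/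
def vertexArc (p : (G.Vert × Fin 3 × Fin n) × Bool) : G.StrandEnd fun _ => 2 * n :=
  if p.2 then ⟨G.halfEdge p.1.1 (p.1.2.1 + 1), ⟨p.1.2.2, by change _ < 2 * n; omega⟩⟩
  else ⟨G.halfEdge p.1.1 p.1.2.1, ⟨2 * n - 1 - p.1.2.2, by change _ < 2 * n; omega⟩⟩

/-- At each slot the places below `n` are joined to the preceding slot, the remaining `n` to the
following one. -/
theorem vertexArc_bijective [IsEmpty G.Triv] : Function.Bijective (G.vertexArc n) := by
  have hval : ∀ p, ((G.vertexArc n p).2 : ℕ) =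
      if p.2 then (p.1.2.2 : ℕ) else 2 * n - 1 - p.1.2.2 := by
    rintro ⟨⟨v, k, j⟩, _ | _⟩ <;> rfl
  constructor
  · intro p q hpq
    have h2 : ((G.vertexArc n p).2 : ℕ) = (G.vertexArc n q).2 := by rw [hpq]
    have h1 : (G.vertexArc n p).1 = (G.vertexArc n q).1 := by rw [hpq]
    rw [hval, hval] at h2
    obtain ⟨⟨v, k, j⟩, x⟩ := p
    obtain ⟨⟨w, l, i⟩, y⟩ := q
    cases x <;> cases y <;> simp only [vertexArc, if_true, Bool.false_eq_true, if_false] at h1 h2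
    · have h3 := G.halfEdge_injective (a₁ := (v, k)) (a₂ := (w, l)) h1
      have h4 : j = i := Fin.ext (by omega)
      simp only [Prod.mk.injEq] at h3
      simp [h3.1, h3.2, h4]
    · omega
    · omega
    · have h3 := G.halfEdge_injective (a₁ := (v, k + 1)) (a₂ := (w, l + 1)) h1
      have h4 : j = i := Fin.ext h2
      simp only [Prod.mk.injEq, add_left_inj] at h3
      simp [h3.1, h3.2, h4]
  · rintro ⟨h, i⟩
    obtain ⟨v, k, rfl⟩ := G.exists_halfEdge_eq h
    have hi' : (i : ℕ) < 2 * n := i.2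
    by_cases hi : (i : ℕ) < n
    · refine ⟨((v, k - 1, ⟨i, hi⟩), true), ?_⟩
      simp [vertexArc]
    · refine ⟨((v, k, ⟨2 * n - 1 - i, by omega⟩), false), ?_⟩
      simp only [vertexArc, Bool.false_eq_true, if_false]
      congr 1
      exact Fin.ext (by simp only; omega)

/-- The matching of the strand ends by the arcs inside the vertices. -/
noncomputable def vertexMatching [IsEmpty G.Triv] :
    (G.Vert × Fin 3 × Fin n) × Bool ≃ G.StrandEnd fun _ => 2 * n :=
  Equiv.ofBijective _ (G.vertexArc_bijective n)

/-- The matching of the strand ends by parallel strands along the edges. -/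
def parallelMatching : (G.Edge × Fin (2 * n)) × Bool ≃ G.StrandEnd fun _ => 2 * n where
  toFun p := ⟨(p.1.1, p.2), if p.2 then Fin.rev p.1.2 else p.1.2⟩
  invFun q := ((q.1.1, if q.1.2 then Fin.rev q.2 else q.2), q.1.2)
  left_inv := by rintro ⟨⟨e, i⟩, _ | _⟩ <;> simp
  right_inv := by rintro ⟨⟨e, _ | _⟩, i⟩ <;> simp

/-- The action of a state on the `true` ends of the strands. -/
def statePerm (σ : G.State fun _ => 2 * n) : Equiv.Perm ((G.Edge × Fin (2 * n)) × Bool) :=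
  Equiv.prodCongrLeft fun b => if b then Equiv.prodCongrRight σ else 1

/-- The matching of the strand ends by the strands of a state. -/
def stateMatching (σ : G.State fun _ => 2 * n) :
    (G.Edge × Fin (2 * n)) × Bool ≃ G.StrandEnd fun _ => 2 * n :=
  (G.statePerm n σ).trans (G.parallelMatching n)

theorem sign_statePerm [DecidableEq G.Edge] (σ : G.State fun _ => 2 * n) :
    Equiv.Perm.sign (G.statePerm n σ) = ∏ e, Equiv.Perm.sign (σ e) := by
  rw [statePerm, Equiv.Perm.sign_prodCongrLeft, Fintype.prod_bool, if_pos rfl,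
    if_neg (by simp), Equiv.Perm.sign_one, mul_one, Equiv.Perm.sign_prodCongrRight]

theorem joined_iff_matchRel [IsEmpty G.Triv] (σ : G.State fun _ => 2 * n)
    (p q : G.StrandEnd fun _ => 2 * n) :
    G.Joined (fun _ => 2 * n) σ p q ↔
      MatchRel (G.vertexMatching n) (G.stateMatching n σ) p q := by
  constructor
  · rintro (⟨e, i⟩ | ⟨v, k, i, j, hij, hj⟩ | ⟨t, i⟩)
    · exact Or.inr ⟨(e, i), rfl, rfl⟩
    · simp only [deco] at i j hij hj
      have hjn : (j : ℕ) < n := by omega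
      refine Or.inl ⟨(v, k, ⟨j, hjn⟩), ?_, rfl⟩
      change _ = (⟨G.halfEdge v k, ⟨2 * n - 1 - j, _⟩⟩ : G.StrandEnd fun _ => 2 * n)
      congr 1
      exact Fin.ext (by simp only; omega)
    · exact isEmptyElim t
  · rintro (⟨⟨v, k, j⟩, rfl, rfl⟩ | ⟨⟨e, i⟩, rfl, rfl⟩)
    · refine Joined.vertex v k (⟨2 * n - 1 - j, by simp only [deco]; omega⟩)
        (⟨j, by simp only [deco]; omega⟩) ?_ ?_
      · simp only [deco]; omega
      · simp only [deco]; omega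
    · exact Joined.bar (γ := fun _ => 2 * n) e i

open Classical in
/-- Up to a global sign, the Penrose evaluation is the full contraction of alternating forms
along the arcs at the vertices and the strands of the states. -/
theorem exists_penroseEval_eq_contraction [IsEmpty G.Triv] :
    ∃ κ : ℤ, |κ| = 1 ∧ G.penroseEval (fun _ => 2 * n) = κ * ∑ σ : G.State fun _ => 2 * n,
      ∑ s : (G.StrandEnd fun _ => 2 * n) → Bool,
        (∏ a, boolAlt (s (G.vertexMatching n (a, false))) (s (G.vertexMatching n (a, true)))) *
          ∏ i, boolAlt (s (G.stateMatching n σ (i, false)))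
            (s (G.stateMatching n σ (i, true))) := by
  have hcard : Fintype.card (G.Vert × Fin 3 × Fin n) = Fintype.card (G.Edge × Fin (2 * n)) := by
    have h := Fintype.card_congr ((G.vertexMatching n).trans (G.parallelMatching n).symm)
    rw [Fintype.card_prod, Fintype.card_prod (G.Edge × Fin (2 * n))] at h
    exact Nat.eq_of_mul_eq_mul_right (by simp) h
  -- Any relabelling of the vertex arcs will do: it changes neither the curves nor the product of
  -- forms, and its effect on the sign is absorbed in `κ₀`, which does not depend on the state.
  let θ := Fintype.equivOfCardEq hcard
  let φ : (G.Edge × Fin (2 * n)) × Bool ≃ G.StrandEnd fun _ => 2 * n :=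
    (θ.symm.prodCongr (Equiv.refl Bool)).trans (G.vertexMatching n)
  let κ₀ : ℤ := Equiv.Perm.sign (φ.trans (G.parallelMatching n).symm)
  let m := Fintype.card (G.Edge × Fin (2 * n))
  have hκ₀ : κ₀ * κ₀ = 1 := by
    simp only [κ₀]
    rw [← Units.val_mul, Int.units_mul_self, Units.val_one]
  have hm : ((-1 : ℤ) ^ m) * (-1) ^ m = 1 := by rw [← mul_pow]; simp
  refine ⟨κ₀ * (-1) ^ m, ?_, ?_⟩
  · rw [abs_mul, abs_pow, abs_neg, abs_one, one_pow, mul_one]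
    exact Int.isUnit_iff_abs_eq.mp (Units.isUnit _)
  rw [penroseEval, Finset.mul_sum]
  refine Finset.sum_congr rfl fun σ _ => ?_
  have h1 : ∀ s : (G.StrandEnd fun _ => 2 * n) → Bool,
      ∏ a, boolAlt (s (G.vertexMatching n (a, false))) (s (G.vertexMatching n (a, true))) =
      ∏ i, boolAlt (s (φ (i, false))) (s (φ (i, true))) := fun s =>
    (θ.symm.prod_comp fun a =>
      boolAlt (s (G.vertexMatching n (a, false))) (s (G.vertexMatching n (a, true)))).symm
  have hQ : G.numCurves (fun _ => 2 * n) σ =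
      Nat.card (Quot (MatchRel φ (G.stateMatching n σ))) := by
    have h : G.Joined (fun _ => 2 * n) σ = MatchRel φ (G.stateMatching n σ) := by
      funext p q
      refine propext ((G.joined_iff_matchRel n σ p q).trans (or_congr ?_ Iff.rfl))
      exact θ.exists_congr fun a => by simp [φ]
    rw [numCurves, h]
  have h2 : φ.trans (G.stateMatching n σ).symm =
      (φ.trans (G.parallelMatching n).symm).trans (G.statePerm n σ).symm := rfl
  rw [Finset.sum_congr rfl fun s _ => congrArg (· * _) (h1 s), sum_prod_boolAlt, h2,
    Equiv.Perm.sign_trans, Equiv.Perm.sign_symm, sign_statePerm, hQ, Units.val_mul,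
    Units.coe_prod]
  change _ = κ₀ * (-1) ^ m * (_ * κ₀ * (-1) ^ m * _)
  linear_combination (-(∏ e, (Equiv.Perm.sign (σ e) : ℤ)) *
    (-2) ^ Nat.card (Quot (MatchRel φ (G.stateMatching n σ)))) * (κ₀ * κ₀ * hm + hκ₀)

open Classical in
/-- An upper bound for the Penrose evaluation in the uniform decoration by `2 * n`. -/
theorem abs_penroseEval_le [IsEmpty G.Triv] (hn : 0 < n) :
    |(G.penroseEval (fun _ => 2 * n) : ℝ)| ≤
      ((2 * (n : ℝ) + 1) ^ 2 * (2 * n).factorial) ^ Fintype.card G.Edge *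
        (√(27 / 64) ^ n) ^ Fintype.card G.Vert := by
  obtain ⟨coef, u, v, hu, hv, hcoef, hdec⟩ :=
    exists_antisymmetrizer_decomposition (c := 2 * n) (by omega)
  obtain ⟨κ, hκ, hP⟩ := G.exists_penroseEval_eq_contraction n
  let L := Fin (2 * n + 1) × Fin (2 * n + 1) × Fin (2 * n + 1)
  let U : (G.Edge → L) → G.Edge × Bool → Bool → ℂ := fun l h => if h.2 then v (l h.1) else u (l h.1)
  have hU : ∀ l h, ‖U l h false‖ ^ 2 + ‖U l h true‖ ^ 2 = 1 := by
    rintro l ⟨e, _ | _⟩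
    · exact hu _
    · exact hv _
  have hstate : ∀ s : (G.StrandEnd fun _ => 2 * n) → Bool,
      ∑ σ : G.State fun _ => 2 * n, ∏ i, (boolAlt (s (G.stateMatching n σ (i, false)))
        (s (G.stateMatching n σ (i, true))) : ℂ) =
      ∑ l : G.Edge → L, (∏ e, coef (l e)) * ∏ x, U l x.1 (s x) := by
    intro s
    have h1 : ∀ σ : G.State fun _ => 2 * n, ∏ i, (boolAlt (s (G.stateMatching n σ (i, false)))
        (s (G.stateMatching n σ (i, true))) : ℂ) =
        ∏ e, ∏ i, (boolAlt (s ⟨(e, false), i⟩) (s ⟨(e, true), Fin.rev (σ e i)⟩) : ℂ) := by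
      intro σ
      rw [Fintype.prod_prod_type]
      rfl
    have h2 : ∀ e, ∑ τ : Equiv.Perm (Fin (2 * n)),
        ∏ i, (boolAlt (s ⟨(e, false), i⟩) (s ⟨(e, true), Fin.rev (τ i)⟩) : ℂ) =
        ∑ l, coef l * ((∏ i, u l (s ⟨(e, false), i⟩)) * ∏ i, v l (s ⟨(e, true), i⟩)) := by
      intro e
      rw [hdec (fun i => s ⟨(e, false), i⟩) (fun i => s ⟨(e, true), Fin.rev i⟩)]
      refine Finset.sum_congr rfl fun l _ => ?_
      congr 2
      -- All strands at one end of an edge carry the same vector, so the reversal of places is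
      -- invisible.
      exact Fin.revPerm.bijective.prod_comp fun i : Fin (2 * n) => v l (s ⟨(e, true), i⟩)
    rw [Finset.sum_congr rfl fun σ _ => h1 σ,
      ← Fintype.prod_sum fun e (τ : Equiv.Perm (Fin (2 * n))) =>
        ∏ i, (boolAlt (s ⟨(e, false), i⟩) (s ⟨(e, true), Fin.rev (τ i)⟩) : ℂ),
      Finset.prod_congr rfl fun e _ => h2 e, Fintype.prod_sum]
    refine Finset.sum_congr rfl fun l _ => ?_
    rw [Finset.prod_mul_distrib, Fintype.prod_sigma, Fintype.prod_prod_type]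
    congr 1
    refine Finset.prod_congr rfl fun e _ => ?_
    rw [Fintype.prod_bool, mul_comm]
    rfl
  -- Once a pair of vectors is chosen on every edge, the sum over colourings factors along the arcs;
  -- the `n` arcs of a corner give equal factors.
  have hPC : (G.penroseEval (fun _ => 2 * n) : ℂ) = κ * ∑ l : G.Edge → L, (∏ e, coef (l e)) *
      ∏ w : G.Vert, ∏ k : Fin 3,
        altForm (U l (G.halfEdge w k)) (U l (G.halfEdge w (k + 1))) ^ n := by
    rw [hP, Finset.sum_comm]
    push_cast
    congr 1
    simp only [← Finset.mul_sum]
    have h4 : ∀ s : (G.StrandEnd fun _ => 2 * n) → Bool,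
        (∏ a, (boolAlt (s (G.vertexMatching n (a, false)))
          (s (G.vertexMatching n (a, true))) : ℂ)) *
        ∑ σ : G.State fun _ => 2 * n, ∏ i, (boolAlt (s (G.stateMatching n σ (i, false)))
          (s (G.stateMatching n σ (i, true))) : ℂ) =
        ∑ l : G.Edge → L, (∏ a, (boolAlt (s (G.vertexMatching n (a, false)))
          (s (G.vertexMatching n (a, true))) : ℂ)) *
            ((∏ e, coef (l e)) * ∏ x, U l x.1 (s x)) := fun s => by
      rw [hstate s, Finset.mul_sum]
    refine (Finset.sum_congr rfl fun s _ => h4 s).trans ?_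
    rw [Finset.sum_comm]
    refine Finset.sum_congr rfl fun l _ => ?_
    have h3 := sum_prod_boolAlt_mul_prod (G.vertexMatching n) (fun x => U l x.1)
    rw [Fintype.prod_prod_type, Finset.prod_congr rfl fun w _ => Fintype.prod_prod_type _] at h3
    simp only [mul_left_comm _ (∏ e, coef (l e)), ← Finset.mul_sum]
    rw [h3]
    congr 1
    refine Finset.prod_congr rfl fun w _ => Finset.prod_congr rfl fun k _ => ?_
    have h5 : ∀ j, altForm (U l (G.vertexMatching n ((w, k, j), false)).1)
        (U l (G.vertexMatching n ((w, k, j), true)).1) =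
        altForm (U l (G.halfEdge w k)) (U l (G.halfEdge w (k + 1))) := fun j => rfl
    simp [h5]
  have hvert : ∀ l : G.Edge → L, ‖∏ w : G.Vert, ∏ k : Fin 3,
      altForm (U l (G.halfEdge w k)) (U l (G.halfEdge w (k + 1))) ^ n‖ ≤
      (√(27 / 64) ^ n) ^ Fintype.card G.Vert := by
    intro l
    rw [norm_prod, ← Finset.card_univ, ← Finset.prod_const]
    refine Finset.prod_le_prod (fun _ _ => norm_nonneg _) fun w _ => ?_
    rw [Finset.prod_pow, norm_pow, norm_prod]
    gcongr
    exact prod_norm_altForm_le (fun k => U l (G.halfEdge w k)) fun k => hU _ _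
  have hcoef' : ∑ l : G.Edge → L, ‖∏ e, coef (l e)‖ ≤
      ((2 * (n : ℝ) + 1) ^ 2 * (2 * n).factorial) ^ Fintype.card G.Edge := by
    simp only [norm_prod]
    rw [← Fintype.prod_sum fun (_ : G.Edge) (j : L) => ‖coef j‖, Finset.prod_const,
      Finset.card_univ]
    refine pow_le_pow_left₀ (Finset.sum_nonneg fun _ _ => norm_nonneg _) ?_ _
    push_cast at hcoef
    exact hcoef
  have hκ' : ‖(κ : ℂ)‖ = 1 := by
    rw [Complex.norm_intCast, ← Int.cast_abs, hκ, Int.cast_one]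
  rw [← Complex.norm_intCast, hPC, norm_mul, hκ', one_mul]
  calc _ ≤ ∑ l : G.Edge → L, ‖∏ e, coef (l e)‖ * (√(27 / 64) ^ n) ^ Fintype.card G.Vert := by
        refine (norm_sum_le _ _).trans (Finset.sum_le_sum fun l _ => ?_)
        rw [norm_mul]
        gcongr
        exact hvert l
    _ ≤ _ := by
        rw [← Finset.sum_mul]
        gcongr

end Uniform

end CubicRibbonGraph

/-! ### Growth of the standard evaluation and the spectral radius -/

namespace CubicRibbonGraph

variable (G : CubicRibbonGraph.{u}) (n : ℕ)

/-- From `2E = 3V` one gets `16 ^ E = 64 ^ V`, which cancels the denominator; squaring avoids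
half-integral exponents. -/
theorem four_pow_mul_sqrt_pow_sq [IsEmpty G.Triv] :
    (4 ^ Fintype.card G.Edge * √(27 / 64) ^ Fintype.card G.Vert : ℝ) ^ 2 =
      27 ^ Fintype.card G.Vert := by
  have h := G.card_vert_mul_three
  rw [mul_pow, ← pow_mul, ← h, ← pow_mul, mul_comm _ 2, mul_comm _ 3, pow_mul _ 2,
    Real.sq_sqrt (by norm_num), pow_mul, ← mul_pow]
  norm_num

/-- An upper bound for the standard evaluation in the uniform decoration by `2 * n`. -/
theorem abs_standardEval_le [IsEmpty G.Triv] (hn : 0 < n) :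
    |G.standardEval (fun _ => 2 * n)| ≤ (2 * (n : ℝ) + 1) ^ (2 * Fintype.card G.Edge) *
      (4 ^ Fintype.card G.Edge * √(27 / 64) ^ Fintype.card G.Vert) ^ n := by
  -- Each vertex contributes `(n!) ^ 3`, and `3V = 2E` redistributes these factorials as `(n!) ^ 2`
  -- per edge, to be compared with `(2n)!`.
  have hs : G.standardEval (fun _ => 2 * n) =
      G.penroseEval (fun _ => 2 * n) * (((n.factorial : ℝ) ^ 2) ^ Fintype.card G.Edge)⁻¹ := by
    have h1 : (2 * n + 2 * n - 2 * n) / 2 = n := by omega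
    rw [standardEval]
    simp only [deco, h1]
    rw [Finset.prod_const, Finset.card_univ, ← pow_mul, mul_comm 2 (Fintype.card G.Edge),
      ← G.card_vert_mul_three, mul_comm _ 3, pow_mul, inv_pow]
    push_cast
    congr 3
    ring
  have hfac : ((2 * n).factorial : ℝ) ≤ 4 ^ n * (n.factorial : ℝ) ^ 2 := by
    have h1 : (2 * n).factorial = n.centralBinom * n.factorial ^ 2 := by
      rw [Nat.centralBinom, ← Nat.choose_mul_factorial_mul_factorial (show n ≤ 2 * n by omega),
        show 2 * n - n = n by omega]
      ring
    have h2 : n.centralBinom ≤ 4 ^ n := by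
      have := Nat.choose_le_two_pow (2 * n) n
      rwa [pow_mul] at this
    rw [h1]
    push_cast
    gcongr
    exact_mod_cast h2
  have hpos : (0 : ℝ) < ((n.factorial : ℝ) ^ 2) ^ Fintype.card G.Edge := by positivity
  rw [hs, abs_mul, abs_of_pos (inv_pos.mpr hpos), mul_inv_le_iff₀ hpos]
  refine (G.abs_penroseEval_le n hn).trans ?_
  calc _ ≤ ((2 * (n : ℝ) + 1) ^ 2 * (4 ^ n * (n.factorial : ℝ) ^ 2)) ^ Fintype.card G.Edge *
        (√(27 / 64) ^ n) ^ Fintype.card G.Vert := by gcongr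
    _ = _ := by
      rw [mul_pow, mul_pow, mul_pow, ← pow_mul, ← pow_mul 4, ← pow_mul √(27 / 64), ← pow_mul 4,
        ← pow_mul √(27 / 64), mul_comm n, mul_comm n]
      ring

end CubicRibbonGraph

theorem mainTheorem4 (N : SpinNetwork.{u}) (hTriv : IsEmpty N.Triv) (hTwo : ∀ e, N.γ e = 2) :
    N.spectralRadius ≤ (3 : ENNReal) ^ ((3 * (Fintype.card N.Vert : ℝ)) / 2) := by
  set R : ℝ := 4 ^ Fintype.card N.Edge * √(27 / 64) ^ Fintype.card N.Vert with hR
  have hRpos : 0 < R := by positivity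
  have hR3 : (3 : ℝ) ^ ((3 * (Fintype.card N.Vert : ℝ)) / 2) = R := by
    have h1 := N.four_pow_mul_sqrt_pow_sq
    rw [← hR] at h1
    rw [← Real.sqrt_sq hRpos.le, h1, Real.sqrt_eq_rpow, ← Real.rpow_natCast,
      show (27 : ℝ) = 3 ^ (3 : ℝ) by norm_num, ← Real.rpow_mul (by norm_num),
      ← Real.rpow_mul (by norm_num)]
    congr 1
    ring
  have hK : (3 : ENNReal) ^ ((3 * (Fintype.card N.Vert : ℝ)) / 2) = ENNReal.ofReal R := by
    rw [← hR3, ← ENNReal.ofReal_rpow_of_pos (by norm_num)]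
    norm_num
  have hcoeff : ∀ n, (N.dilate n).standardEval =
      N.toCubicRibbonGraph.standardEval (fun _ => 2 * n) := by
    intro n
    have h1 : (fun e => n * N.γ e) = fun _ => 2 * n := by
      funext e
      rw [hTwo, mul_comm]
    change N.toCubicRibbonGraph.standardEval (fun e => n * N.γ e) = _
    rw [h1]
  rw [hK, SpinNetwork.spectralRadius, ENNReal.inv_le_iff_inv_le, ← ENNReal.ofReal_inv_of_pos hRpos]
  -- For `r < R⁻¹` the geometric decay of `(R * r) ^ n` beats the polynomial factor, so the terms of
  -- the series at `r` are eventually bounded.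
  refine ENNReal.le_of_forall_nnreal_lt fun r hr => ?_
  rw [ENNReal.lt_ofReal_iff_toReal_lt ENNReal.coe_ne_top, ENNReal.coe_toReal] at hr
  have hRr : |R * r| < 1 := by
    rw [abs_of_nonneg (by positivity)]
    calc R * r < R * R⁻¹ := by gcongr
      _ = 1 := mul_inv_cancel₀ hRpos.ne'
  have hlim := tendsto_pow_const_mul_const_pow_of_abs_lt_one (2 * Fintype.card N.Edge) hRr
  -- The constant comes from `2n + 1 ≤ 3n` for `n ≥ 1`.
  refine N.generatingSeries.le_radius_of_eventually_le (3 ^ (2 * Fintype.card N.Edge)) ?_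
  filter_upwards [hlim.eventually (gt_mem_nhds one_pos), Filter.eventually_gt_atTop 0] with n h1 hn
  rw [SpinNetwork.generatingSeries, FormalMultilinearSeries.ofScalars_norm, Real.norm_eq_abs,
    hcoeff]
  have hn1 : (1 : ℝ) ≤ n := by exact_mod_cast hn
  calc _ ≤ ((2 * (n : ℝ) + 1) ^ (2 * Fintype.card N.Edge) * R ^ n) * (r : ℝ) ^ n := by
        gcongr
        exact N.abs_standardEval_le n hn
    _ ≤ ((3 * (n : ℝ)) ^ (2 * Fintype.card N.Edge) * R ^ n) * (r : ℝ) ^ n := by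
        gcongr
        linarith
    _ = 3 ^ (2 * Fintype.card N.Edge) * ((n : ℝ) ^ (2 * Fintype.card N.Edge) * (R * r) ^ n) := by
        rw [mul_pow, mul_pow]
        ring
    _ ≤ 3 ^ (2 * Fintype.card N.Edge) * 1 := by gcongr
    _ = _ := mul_one _
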